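/- Let $n\ge 1$. A lattice $n$-polytope is a convex polytope $P\subset\mathbb{R}^n$ of dimension $n$ all of whose vertices lie in $\mathbb{Z}^n$. Let $\mathrm{vol}$ denote $n$-dimensional Lebesgue measure, $\mathrm{int}$ the interior, and $\mathrm{G}(S)=\#(S\cap\mathbb{Z}^n)$. For an integer $l\ge 0$ put $$S_n(l)=\mathrm{conv}\Big\{e_1,\dots,e_n,\,-l\sum_{i=1}^n e_i\Big\},$$ where $e_1,\dots,e_n$ are the standard unit vectors. Then: 1. Every lattice $n$-polytope $P$ satisfies $$\mathrm{vol}(P)\ \ge\ \frac{n\,\mathrm{G}(\mathrm{int}\,P)+1}{n!}.$$ 2. This bound is best possible for every number of interior lattice points: for every integer $l\ge 0$, $S_n(l)$ is a lattice $n$-polytope with $\mathrm{G}(\mathrm{int}\,S_n(l))=l$ and $\mathrm{vol}(S_n(l))=\frac{n\,l+1}{n!}$. 3. If $P$ is a lattice $n$-polytope with $\mathrm{G}(\mathrm{int}\,P)=1$, then equality holds in 1 if and only if $P$ is unimodularly equivalent to $S_n(1)$, i.e. there are $U\in\mathrm{GL}_n(\mathbb{Z})$ and $t\in\mathbb{Z}^n$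 with $\{Ux+t : x\in P\}=S_n(1)$. -/

import Mathlib

open MeasureTheory

noncomputable section

namespace EhrhartVolume

/-- `x ∈ ℝⁿ` belongs to the standard lattice `ℤⁿ`. -/
def IsLatticePoint {n : ℕ} (x : EuclideanSpace ℝ (Fin n)) : Prop :=
  ∃ z : Fin n → ℤ, ∀ i, x i = (z i : ℝ)

/-- The lattice point enumerator `G(S) = #(S ∩ ℤⁿ)`.
It is only used for bounded sets, where the set counted is finite. -/
def latticeCount {n : ℕ} (S : Set (EuclideanSpace ℝ (Fin n))) : ℕ :=
  Set.ncard {x | x ∈ S ∧ IsLatticePoint x}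

/-- `P` is a convex lattice `n`-polytope in `ℝⁿ`: the convex hull of finitely many points,
all of whose vertices (extreme points) are lattice points, and of dimension `n`
(its affine hull is the whole space). -/
structure IsLatticePolytope {n : ℕ} (P : Set (EuclideanSpace ℝ (Fin n))) : Prop where
  polytope : ∃ V : Set (EuclideanSpace ℝ (Fin n)), V.Finite ∧ P = convexHull ℝ V
  vertices : ∀ v ∈ P.extremePoints ℝ, IsLatticePoint v
  fullDim : affineSpan ℝ P = ⊤

/-- The simplex `S_n(l) = conv {e_1, …, e_n, -l (e_1 + … + e_n)}`. -/
def simplexS (n l : ℕ) : Set (EuclideanSpace ℝ (Fin n)) :=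
  convexHull ℝ
    (insert (-((l : ℝ) • ∑ i : Fin n, EuclideanSpace.single i (1 : ℝ)))
      (Set.range fun i : Fin n => EuclideanSpace.single i (1 : ℝ)))

/-- `P` and `Q` are unimodularly equivalent: `Q` is the image of `P` under an affine map
`x ↦ U x + t` with `U ∈ GL_n(ℤ)` and `t ∈ ℤⁿ`. -/
def UnimodularEquiv {n : ℕ} (P Q : Set (EuclideanSpace ℝ (Fin n))) : Prop :=
  ∃ (U : Matrix (Fin n) (Fin n) ℤ) (t : Fin n → ℤ), IsUnit U.det ∧
    Q = (fun x : EuclideanSpace ℝ (Fin n) =>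
      WithLp.toLp 2 (fun i => (∑ j, (U i j : ℝ) * x j) + (t i : ℝ))) '' P

end EhrhartVolume

end

/-! Cover `P` by simplices spanned by its vertices with total normalized volume at most `n! vol(P)`,
then insert the interior lattice points one by one. Star subdivision at `p` keeps the total
normalized volume: replacing vertex `i` by `p` multiplies the determinant by the `i`-th barycentric
coordinate of `p`, and these sum to 1. Each insertion creates at least `n` new cells. A lattice
simplex has normalized volume at least 1, so `1 + n G(int P)` is at most the final number of cells,
hence at most `n! vol(P)`.

The gain of `n` is `le_sum_card_carrier_sub_one`. If the faces carrying `p` in the cells around it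
had dimensions summing to less than `n`, some direction would leave all these cells at once,
although they cover a neighbourhood of `p`. No face-to-face condition is needed. The initial cover
(`exists_dissection`) is the regular triangulation given by generic heights.

If `G(int P) = 1` and equality holds, the initial cover is a single simplex. Subdividing it at `p`
gives `n + 1` lattice simplices of total normalized volume `n + 1`, so all are unimodular and `p` is
the centroid, which determines the simplex up to unimodular equivalence. -/

namespace EhrhartVolume

variable {n : ℕ}

/-! ### Determinants of simplices -/

/-- The matrix whose rows are the points `b i` in homogeneous coordinates. -/
def vertexMatrix (b : Fin (n + 1) → EuclideanSpace ℝ (Fin n)) :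
    Matrix (Fin (n + 1)) (Fin (n + 1)) ℝ :=
  Matrix.of fun i => Fin.cons 1 (b i).ofLp

lemma det_vertexMatrix (b : Fin (n + 1) → EuclideanSpace ℝ (Fin n)) :
    (vertexMatrix b).det
      = (Matrix.of fun i j : Fin n => b i.succ j - b 0 j).det := by
  have h := Matrix.det_eq_of_forall_row_eq_smul_add_const (A := vertexMatrix b)
    (B := Matrix.of fun i j => vertexMatrix b i j - if i = 0 then 0 else vertexMatrix b 0 j)
    (fun i => if i = 0 then 0 else 1) 0 (by simp) (by intro i j; split_ifs <;> simp [*])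
  rw [h, Matrix.det_succ_column_zero, Fin.sum_univ_succ]
  simp [vertexMatrix, Fin.succ_ne_zero]
  congr 1

lemma vecMul_vertexMatrix_eq_zero_iff (b : Fin (n + 1) → EuclideanSpace ℝ (Fin n))
    (w : Fin (n + 1) → ℝ) :
    Matrix.vecMul w (vertexMatrix b) = 0 ↔ ∑ i, w i = 0 ∧ ∑ i, w i • b i = 0 := by
  constructor
  · intro h
    refine ⟨by simpa [Matrix.vecMul, dotProduct, vertexMatrix] using congrFun h 0, ?_⟩
    ext j
    simpa [Matrix.vecMul, dotProduct, vertexMatrix] using congrFun h j.succ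
  · rintro ⟨h1, h2⟩
    ext j
    refine Fin.cases ?_ (fun j => ?_) j
    · simpa [Matrix.vecMul, dotProduct, vertexMatrix] using h1
    · simpa [Matrix.vecMul, dotProduct, vertexMatrix] using congrArg (fun x => x j) h2

lemma affineIndependent_of_det_vertexMatrix_ne_zero
    {b : Fin (n + 1) → EuclideanSpace ℝ (Fin n)} (h : (vertexMatrix b).det ≠ 0) :
    AffineIndependent ℝ b := by
  rw [affineIndependent_iff_of_fintype]
  intro w hw hb i
  rw [Finset.weightedVSub_eq_linear_combination _ hw] at hb
  have := (vecMul_vertexMatrix_eq_zero_iff b w).2 ⟨hw, hb⟩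
  rw [Matrix.eq_zero_of_vecMul_eq_zero h this, Pi.zero_apply]

/-- A simplex with nonzero determinant is an affine basis. -/
noncomputable def affineBasisOfDet (b : Fin (n + 1) → EuclideanSpace ℝ (Fin n))
    (h : (vertexMatrix b).det ≠ 0) :
    AffineBasis (Fin (n + 1)) ℝ (EuclideanSpace ℝ (Fin n)) :=
  ⟨b, affineIndependent_of_det_vertexMatrix_ne_zero h,
    (affineIndependent_of_det_vertexMatrix_ne_zero h).affineSpan_eq_top_iff_card_eq_finrank_add_one.2
      (by simp)⟩

@[simp] lemma coe_affineBasisOfDet (b : Fin (n + 1) → EuclideanSpace ℝ (Fin n))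
    (h : (vertexMatrix b).det ≠ 0) : ⇑(affineBasisOfDet b h) = b := rfl

lemma det_vertexMatrix_ne_zero (b : AffineBasis (Fin (n + 1)) ℝ (EuclideanSpace ℝ (Fin n))) :
    (vertexMatrix b).det ≠ 0 := by
  intro h
  obtain ⟨w, hw, h0⟩ := Matrix.exists_vecMul_eq_zero_iff.2 h
  obtain ⟨h1, h2⟩ := (vecMul_vertexMatrix_eq_zero_iff _ w).1 h0
  refine hw (funext fun i => ?_)
  refine (affineIndependent_iff_of_fintype ℝ _).1 b.ind w h1 ?_ i
  rw [Finset.weightedVSub_eq_linear_combination _ h1, h2]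

/-- Cramer's rule: in homogeneous coordinates `p` is the combination of the rows with its
barycentric coordinates as coefficients, and only the `i`-th term survives. -/
lemma det_vertexMatrix_update (b : AffineBasis (Fin (n + 1)) ℝ (EuclideanSpace ℝ (Fin n)))
    (i : Fin (n + 1)) (p : EuclideanSpace ℝ (Fin n)) :
    (vertexMatrix (Function.update b i p)).det = b.coord i p * (vertexMatrix b).det := by
  have h : vertexMatrix (Function.update b i p)
      = (vertexMatrix b).updateRow i (∑ k, b.coord k p • vertexMatrix b k) := by
    ext k j
    by_cases hk : k = i
    · subst hk
      rw [Matrix.updateRow_self]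
      refine Fin.cases ?_ (fun j => ?_) j
      · simp [vertexMatrix]
      · conv_lhs => simp [vertexMatrix]
        have h := congrArg (fun x => x j) (b.linear_combination_coord_eq_self p)
        simp only [WithLp.ofLp_sum, Finset.sum_apply, WithLp.ofLp_smul, Pi.smul_apply,
          smul_eq_mul] at h
        simpa [vertexMatrix] using h.symm
    · simp [vertexMatrix, hk]
  rw [h, Matrix.det_updateRow_sum]
  simp

lemma exists_int_det_vertexMatrix {b : Fin (n + 1) → EuclideanSpace ℝ (Fin n)}
    (hb : ∀ i, IsLatticePoint (b i)) : ∃ d : ℤ, (vertexMatrix b).det = d := by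
  choose z hz using hb
  refine ⟨(Matrix.of fun i => Fin.cons 1 (z i) : Matrix (Fin (n + 1)) (Fin (n + 1)) ℤ).det, ?_⟩
  have : vertexMatrix b = (Int.castRingHom ℝ).mapMatrix
      (Matrix.of fun i => Fin.cons 1 (z i) : Matrix (Fin (n + 1)) (Fin (n + 1)) ℤ) := by
    ext i j
    refine Fin.cases ?_ (fun j => ?_) j <;> simp [vertexMatrix, hz]
  rw [this, ← RingHom.map_det]
  simp

lemma one_le_abs_det_vertexMatrix {b : Fin (n + 1) → EuclideanSpace ℝ (Fin n)}
    (hb : ∀ i, IsLatticePoint (b i)) (h : (vertexMatrix b).det ≠ 0) :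
    1 ≤ |(vertexMatrix b).det| := by
  obtain ⟨d, hd⟩ := exists_int_det_vertexMatrix hb
  rw [hd] at h ⊢
  exact_mod_cast Int.one_le_abs (by exact_mod_cast h)

/-! ### Volume of a simplex -/

/-- Induction by slicing: the slice at first coordinate `t` is the corner of size `r - t`, which is
why `r` is arbitrary. -/
lemma volume_corner_pi (n : ℕ) (r : ℝ) (hr : 0 ≤ r) :
    volume {x : Fin n → ℝ | (∀ i, 0 ≤ x i) ∧ ∑ i, x i ≤ r}
      = ENNReal.ofReal (r ^ n / n.factorial) := by
  induction n generalizing r with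
  | zero => simp [hr, Measure.volume_pi_eq_dirac (0 : Fin 0 → ℝ)]
  | succ n ih =>
    have hmeas : ∀ m : ℕ, ∀ s : ℝ, MeasurableSet {x : Fin m → ℝ | (∀ i, 0 ≤ x i) ∧ ∑ i, x i ≤ s} := by
      intro m s
      apply IsClosed.measurableSet
      simp only [Set.ofPred_and, Set.ofPred_forall]
      refine IsClosed.inter (isClosed_iInter fun i => ?_) ?_
      · exact isClosed_le continuous_const (continuous_apply i)
      · exact isClosed_le (by fun_prop) continuous_const
    have hp := (volume_preserving_piFinSuccAbove (fun _ : Fin (n + 1) => ℝ) 0).symm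
    rw [← hp.measure_preimage (hmeas _ _).nullMeasurableSet,
      Measure.volume_eq_prod, Measure.prod_apply (hp.measurable (hmeas _ _))]
    have hs : ∀ t : ℝ, volume (Prod.mk t ⁻¹' ((MeasurableEquiv.piFinSuccAbove
        (fun _ : Fin (n + 1) => ℝ) 0).symm ⁻¹' {x | (∀ i, 0 ≤ x i) ∧ ∑ i, x i ≤ r}))
        = (Set.Icc 0 r).indicator (fun t => ENNReal.ofReal ((r - t) ^ n / n.factorial)) t := by
      intro t
      by_cases ht : t ∈ Set.Icc 0 r
      · rw [Set.indicator_of_mem ht, ← ih (r - t) (by linarith [ht.2])]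
        congr 1
        ext x
        simp [Fin.forall_fin_succ, Fin.sum_univ_succ, ht.1, le_sub_iff_add_le']
      · rw [Set.indicator_of_notMem ht]
        convert measure_empty (μ := volume)
        ext x
        simp only [Set.mem_preimage, Set.mem_ofPred_eq, Set.mem_empty_iff_false, iff_false]
        rintro ⟨h1, h2⟩
        simp [Fin.forall_fin_succ, Fin.sum_univ_succ] at h1 h2
        have := Finset.sum_nonneg fun i (_ : i ∈ Finset.univ) => h1.2 i
        exact ht ⟨h1.1, by linarith⟩
    simp_rw [hs]
    rw [lintegral_indicator measurableSet_Icc, ← ofReal_integral_eq_lintegral_ofReal]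
    · congr 1
      rw [integral_Icc_eq_integral_Ioc, ← intervalIntegral.integral_of_le hr,
        intervalIntegral.integral_div, intervalIntegral.integral_comp_sub_left (fun t => t ^ n)]
      simp [Nat.factorial_succ]
      field_simp
    · exact (Continuous.integrableOn_Icc (by fun_prop))
    · refine (ae_restrict_iff' measurableSet_Icc).2 (.of_forall fun t ht => ?_)
      have : 0 ≤ r - t := by linarith [ht.2]
      simp only [Pi.zero_apply]
      positivity

lemma mem_convexHull_range_iff {κ F : Type*} [Fintype κ] [AddCommGroup F] [Module ℝ F]
    {v : κ → F} {y : F} : y ∈ convexHull ℝ (Set.range v) ↔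
      ∃ w : κ → ℝ, (∀ i, 0 ≤ w i) ∧ ∑ i, w i = 1 ∧ ∑ i, w i • v i = y := by
  classical
  have h : convexHull ℝ (Set.range v)
      = Fintype.linearCombination ℝ v '' stdSimplex ℝ κ := by
    rw [← convexHull_rangle_single_eq_stdSimplex, LinearMap.image_convexHull, ← Set.range_comp]
    congr 2
    ext i
    simp [Fintype.linearCombination_apply_single]
  rw [h]
  simp [stdSimplex, Fintype.linearCombination_apply, and_assoc]

lemma convexHull_range_eq_image_corner (b : Fin (n + 1) → EuclideanSpace ℝ (Fin n)) :
    convexHull ℝ (Set.range b) = (fun x => b 0 + x) ''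
      ((Matrix.toLpLin 2 2 (Matrix.of fun i j : Fin n => b j.succ i - b 0 i)) ''
        {x : EuclideanSpace ℝ (Fin n) | (∀ i, 0 ≤ x i) ∧ ∑ i, x i ≤ 1}) := by
  have key : ∀ w : Fin (n + 1) → ℝ, ∑ i, w i = 1 → ∑ i, w i • b i
      = b 0 + Matrix.toLpLin 2 2 (Matrix.of fun i j : Fin n => b j.succ i - b 0 i)
        (WithLp.toLp 2 fun i => w i.succ) := by
    intro w hw
    rw [Fin.sum_univ_succ] at hw ⊢
    rw [eq_sub_of_add_eq hw]
    ext j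
    simp [Matrix.toLpLin_apply, Matrix.mulVec, dotProduct, sub_mul, Finset.sum_sub_distrib,
      ← Finset.mul_sum]
    simp only [mul_comm]
    ring
  ext y
  rw [mem_convexHull_range_iff, Set.image_image]
  constructor
  · rintro ⟨w, h0, h1, rfl⟩
    refine ⟨WithLp.toLp 2 fun i => w i.succ, ⟨fun i => h0 _, ?_⟩, (key w h1).symm⟩
    rw [Fin.sum_univ_succ] at h1
    linarith [h0 0]
  · rintro ⟨x, ⟨h0, h1⟩, rfl⟩
    have hw : ∑ i, (Fin.cons (1 - ∑ i, x i) x.ofLp : Fin (n + 1) → ℝ) i = 1 := by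
      simp [Fin.sum_univ_succ]
    refine ⟨_, ?_, hw, key _ hw⟩
    refine Fin.cases ?_ fun i => ?_
    · simpa using h1
    · simpa using h0 i

lemma volume_convexHull_range (b : Fin (n + 1) → EuclideanSpace ℝ (Fin n)) :
    volume (convexHull ℝ (Set.range b))
      = ENNReal.ofReal (|(vertexMatrix b).det| / n.factorial) := by
  have hC : volume {x : EuclideanSpace ℝ (Fin n) | (∀ i, 0 ≤ x i) ∧ ∑ i, x i ≤ 1}
      = ENNReal.ofReal (1 / n.factorial) := by
    rw [← (EuclideanSpace.volume_preserving_symm_measurableEquiv_toLp (Fin n)).symm.measure_preimage_equiv]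
    simpa using volume_corner_pi n 1 zero_le_one
  rw [convexHull_range_eq_image_corner, Set.image_add_left, measure_preimage_add,
    Measure.addHaar_image_linearMap, hC, ← ENNReal.ofReal_mul (abs_nonneg _), mul_one_div,
    det_vertexMatrix, ← Matrix.det_transpose, LinearMap.det_toLpLin]
  rfl

/-! ### Star subdivision of a simplex -/

open Classical in
/-- The vertices of a simplex spanning the smallest face that contains `p`. -/
noncomputable def carrier (b : AffineBasis (Fin (n + 1)) ℝ (EuclideanSpace ℝ (Fin n)))
    (p : EuclideanSpace ℝ (Fin n)) : Finset (Fin (n + 1)) :=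
  Finset.univ.filter fun i => 0 < b.coord i p

lemma mem_carrier {b : AffineBasis (Fin (n + 1)) ℝ (EuclideanSpace ℝ (Fin n))}
    {p : EuclideanSpace ℝ (Fin n)} {i : Fin (n + 1)} :
    i ∈ carrier b p ↔ 0 < b.coord i p := by
  simp [carrier]

lemma mem_convexHull_affineBasis_iff {b : AffineBasis (Fin (n + 1)) ℝ (EuclideanSpace ℝ (Fin n))}
    {p : EuclideanSpace ℝ (Fin n)} :
    p ∈ convexHull ℝ (Set.range b) ↔ ∀ i, 0 ≤ b.coord i p := by
  rw [b.convexHull_eq_nonneg_coord]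
  rfl

lemma carrier_nonempty (b : AffineBasis (Fin (n + 1)) ℝ (EuclideanSpace ℝ (Fin n)))
    (p : EuclideanSpace ℝ (Fin n)) : (carrier b p).Nonempty := by
  by_contra h
  have h' : ∀ i, b.coord i p ≤ 0 := fun i => by
    by_contra hi
    exact h ⟨i, mem_carrier.2 (not_le.1 hi)⟩
  have := b.sum_coord_apply_eq_one p
  linarith [Finset.sum_nonpos fun i (_ : i ∈ Finset.univ) => h' i]

lemma one_lt_card_carrier {b : AffineBasis (Fin (n + 1)) ℝ (EuclideanSpace ℝ (Fin n))}
    {p : EuclideanSpace ℝ (Fin n)} (hp : p ∈ convexHull ℝ (Set.range b)) (hv : ∀ i, b i ≠ p) :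
    1 < (carrier b p).card := by
  rw [mem_convexHull_affineBasis_iff] at hp
  obtain ⟨i, hi⟩ := carrier_nonempty b p
  by_contra h
  have h0 : ∀ j, j ≠ i → b.coord j p = 0 := by
    intro j hj
    by_contra hj'
    refine h (Finset.one_lt_card.2 ⟨j, mem_carrier.2 ((hp j).lt_of_ne' hj'), i, hi, hj⟩)
  have h1 : b.coord i p = 1 := by
    rw [← b.sum_coord_apply_eq_one p, Finset.sum_eq_single i (fun j _ hj => h0 j hj) (by simp)]
  refine hv i (b.ext_elem fun j => ?_)
  by_cases hj : j = i
  · subst hj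
    rw [h1, b.coord_apply_eq]
  · rw [h0 j hj, b.coord_apply_ne hj]

/-- Ratio test: subtract from `x` the largest multiple `r` of `p` that keeps all barycentric
coordinates nonnegative. The coordinate attaining the minimal ratio vanishes, so its vertex can be
traded for `p` with weight `r`. -/
lemma exists_mem_convexHull_update
    {b : AffineBasis (Fin (n + 1)) ℝ (EuclideanSpace ℝ (Fin n))} {p x : EuclideanSpace ℝ (Fin n)}
    (hp : p ∈ convexHull ℝ (Set.range b)) (hx : x ∈ convexHull ℝ (Set.range b)) :
    ∃ i ∈ carrier b p, x ∈ convexHull ℝ (Set.range (Function.update b i p)) := by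
  obtain ⟨i, hi, hmin⟩ := (carrier b p).exists_min_image
    (fun i => b.coord i x / b.coord i p) (carrier_nonempty b p)
  refine ⟨i, hi, ?_⟩
  rw [mem_convexHull_affineBasis_iff] at hp hx
  have hi0 := mem_carrier.1 hi
  set r := b.coord i x / b.coord i p with hr
  have hri : b.coord i x - r * b.coord i p = 0 := by rw [hr]; field_simp; simp
  have hr0 : 0 ≤ r := div_nonneg (hx i) hi0.le
  rw [mem_convexHull_range_iff]
  refine ⟨fun k => (b.coord k x - r * b.coord k p) + Pi.single (M := fun _ => ℝ) i r k,
    fun k => ?_, ?_, ?_⟩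
  · refine add_nonneg ?_ ?_
    · by_cases hk : k ∈ carrier b p
      · have := (le_div_iff₀ (mem_carrier.1 hk)).1 (hmin k hk)
        linarith
      · have : b.coord k p = 0 := le_antisymm (not_lt.1 fun h => hk (mem_carrier.2 h)) (hp k)
        simpa [this] using hx k
    · exact (Pi.single_nonneg (α := fun _ => ℝ)).2 hr0 k
  · rw [Finset.sum_add_distrib, Finset.sum_sub_distrib, ← Finset.mul_sum,
      b.sum_coord_apply_eq_one, b.sum_coord_apply_eq_one]
    simp
  · have h1 : ∀ k, ((b.coord k x - r * b.coord k p) + Pi.single (M := fun _ => ℝ) i r k)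
        • Function.update b i p k
        = (b.coord k x • b k - r • (b.coord k p • b k)) + if k = i then r • p else 0 := by
      intro k
      by_cases hk : k = i
      · subst hk
        have : b.coord k x • b k - r • b.coord k p • b k = 0 := by
          rw [smul_smul, ← sub_smul, hri, zero_smul]
        rw [this]
        simp [hri]
      · simp [hk, sub_smul, smul_smul]
    simp_rw [h1]
    rw [Finset.sum_add_distrib, Finset.sum_sub_distrib, ← Finset.smul_sum,
      b.linear_combination_coord_eq_self, b.linear_combination_coord_eq_self]
    simp

open Classical in
lemma exists_star_subdivision (b : AffineBasis (Fin (n + 1)) ℝ (EuclideanSpace ℝ (Fin n)))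
    (p : EuclideanSpace ℝ (Fin n)) :
    ∃ (S : Finset (Fin (n + 1)))
      (b' : Fin (n + 1) → AffineBasis (Fin (n + 1)) ℝ (EuclideanSpace ℝ (Fin n))),
      (∀ x ∈ convexHull ℝ (Set.range b), ∃ i ∈ S, x ∈ convexHull ℝ (Set.range (b' i))) ∧
      ∑ i ∈ S, |(vertexMatrix (b' i)).det| = |(vertexMatrix b).det| ∧
      (∀ i j, b' i j = p ∨ b' i j = b j) ∧
      S.card = if p ∈ convexHull ℝ (Set.range b) then (carrier b p).card else 1 := by
  by_cases hp : p ∈ convexHull ℝ (Set.range b)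
  · have hdet : ∀ i ∈ carrier b p, (vertexMatrix (Function.update b i p)).det ≠ 0 := by
      intro i hi
      rw [det_vertexMatrix_update]
      exact mul_ne_zero (mem_carrier.1 hi).ne' (det_vertexMatrix_ne_zero b)
    -- Off the carrier the replaced simplex is degenerate; `b` is a filler there, never summed over.
    refine ⟨carrier b p, fun i => if h : i ∈ carrier b p then affineBasisOfDet _ (hdet i h) else b,
      fun x hx => ?_, ?_, fun i j => ?_, by rw [if_pos hp]⟩
    · obtain ⟨i, hi, hxi⟩ := exists_mem_convexHull_update hp hx
      exact ⟨i, hi, by simpa [hi] using hxi⟩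
    · calc _ = ∑ i ∈ carrier b p, b.coord i p * |(vertexMatrix b).det| := by
            refine Finset.sum_congr rfl fun i hi => ?_
            simp only [hi, dif_pos, coe_affineBasisOfDet, det_vertexMatrix_update, abs_mul,
              abs_of_pos (mem_carrier.1 hi)]
        _ = ∑ i, b.coord i p * |(vertexMatrix b).det| := by
            refine Finset.sum_subset (Finset.subset_univ _) fun i _ hi => ?_
            have : b.coord i p = 0 := le_antisymm (not_lt.1 fun h => hi (mem_carrier.2 h))
              (mem_convexHull_affineBasis_iff.1 hp i)
            simp [this]
        _ = _ := by rw [← Finset.sum_mul, b.sum_coord_apply_eq_one, one_mul]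
    · dsimp only
      split_ifs with h
      · rw [coe_affineBasisOfDet]
        by_cases hj : j = i
        · subst hj
          simp
        · simp [hj]
      · exact Or.inr rfl
  · exact ⟨{0}, fun _ => b, fun x hx => ⟨0, by simpa using hx⟩, by simp, fun i j => Or.inr rfl,
      by simp [hp]⟩

/-! ### Number of cells gained at an interior point -/

/-- Greedy choice: `W`, of codimension at most the number of indices treated, is killed by all
functionals chosen so far. The dimension bound keeps `W` out of the next `K t`, so a move inside `W`
can make a functional of `t` negative without disturbing the earlier ones. -/
lemma exists_forall_exists_neg {F ι κ : Type*} [AddCommGroup F] [Module ℝ F]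
    [FiniteDimensional ℝ F] (f : ι → κ → Module.Dual ℝ F) (A : Finset ι)
    (K : ι → Submodule ℝ F) (hK : ∀ t ∈ A, ∀ x, (∀ k, f t k x = 0) → x ∈ K t)
    (hdim : ∀ t ∈ A, Module.finrank ℝ (K t) + A.card ≤ Module.finrank ℝ F) :
    ∃ x, ∀ t ∈ A, ∃ k, f t k x < 0 := by
  classical
  suffices h : ∀ B ⊆ A, ∃ (W : Submodule ℝ F) (x : F),
      Module.finrank ℝ F ≤ Module.finrank ℝ W + B.card ∧
      ∀ t ∈ B, ∃ k, f t k x < 0 ∧ ∀ w ∈ W, f t k w = 0 by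
    obtain ⟨W, x, -, hx⟩ := h A subset_rfl
    exact ⟨x, fun t ht => (hx t ht).imp fun k hk => hk.1⟩
  intro B
  induction B using Finset.induction_on with
  | empty => exact fun _ => ⟨⊤, 0, by simp, by simp⟩
  | insert t B ht ih =>
    intro hB
    obtain ⟨W, x, hW, hx⟩ := ih ((Finset.subset_insert _ _).trans hB)
    have htA := hB (Finset.mem_insert_self _ _)
    have hcard := Finset.card_le_card hB
    rw [Finset.card_insert_of_notMem ht] at hcard
    have hnle : ¬ W ≤ K t := fun h => by
      have := Submodule.finrank_mono h
      have := hdim t htA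
      omega
    obtain ⟨w, hw, hwK⟩ := SetLike.not_le_iff_exists.1 hnle
    obtain ⟨k, hk⟩ : ∃ k, f t k w ≠ 0 := by
      by_contra! h
      exact hwK (hK t htA w h)
    -- The multiple of `w` is chosen to bring `f t k` to the value `-1`.
    refine ⟨W ⊓ LinearMap.ker (f t k), x + (-(1 + f t k x) / f t k w) • w, ?_, ?_⟩
    · rw [Finset.card_insert_of_notMem ht]
      have h1 := Submodule.finrank_sup_add_finrank_inf_eq W (LinearMap.ker (f t k))
      have h2 := Submodule.finrank_le (W ⊔ LinearMap.ker (f t k))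
      have h3 := Module.Dual.finrank_ker_add_one_of_ne_zero (f := f t k)
        (by rintro h; simp [h] at hk)
      omega
    · intro s hs
      rcases Finset.mem_insert.1 hs with rfl | hs
      · refine ⟨k, ?_, fun v hv => hv.2⟩
        simp [hk]
      · obtain ⟨k', hk', hW'⟩ := hx s hs
        refine ⟨k', by simpa [hW' w hw] using hk', fun v hv => hW' v hv.1⟩

/-- The directions of the smallest face that contains `p`. -/
noncomputable def carrierDirection (b : AffineBasis (Fin (n + 1)) ℝ (EuclideanSpace ℝ (Fin n)))
    (p : EuclideanSpace ℝ (Fin n)) : Submodule ℝ (EuclideanSpace ℝ (Fin n)) :=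
  ⨅ i : {i // i ∉ carrier b p}, LinearMap.ker (b.coord i).linear

/-- The linear parts of the coordinates sum to zero, so a direction of the face is determined by all
carrier coordinates but one. -/
lemma finrank_carrierDirection_add_one_le
    (b : AffineBasis (Fin (n + 1)) ℝ (EuclideanSpace ℝ (Fin n))) (p : EuclideanSpace ℝ (Fin n)) :
    Module.finrank ℝ (carrierDirection b p) + 1 ≤ (carrier b p).card := by
  obtain ⟨i₀, hi₀⟩ := carrier_nonempty b p
  let g : EuclideanSpace ℝ (Fin n) →ₗ[ℝ] ((carrier b p).erase i₀ → ℝ) :=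
    LinearMap.pi fun i => (b.coord i).linear
  have hcl : ∀ x i, (b.coord i).linear x = b.coord i x - b.coord i 0 := by
    intro x i
    simpa using (b.coord i).linearMap_vsub x 0
  have hg : Function.Injective (g.domRestrict (carrierDirection b p)) := by
    rw [← LinearMap.ker_eq_bot, LinearMap.ker_eq_bot']
    rintro ⟨x, hx⟩ h
    have hx' : ∀ i, i ∉ carrier b p → (b.coord i).linear x = 0 := by
      intro i hi
      have := (Submodule.mem_iInf _).1 hx ⟨i, hi⟩
      simpa using this
    have h' : ∀ i, i ≠ i₀ → (b.coord i).linear x = 0 := by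
      intro i hi
      by_cases hc : i ∈ carrier b p
      · exact congrFun h ⟨i, Finset.mem_erase.2 ⟨hi, hc⟩⟩
      · exact hx' i hc
    have hsum : ∑ i, (b.coord i).linear x = 0 := by
      simp only [hcl, Finset.sum_sub_distrib, b.sum_coord_apply_eq_one, sub_self]
    have h0 : (b.coord i₀).linear x = 0 := by
      rwa [Finset.sum_eq_single i₀ (fun j _ hj => h' j hj) (by simp)] at hsum
    refine Subtype.ext (b.ext_elem fun i => ?_)
    have : (b.coord i).linear x = 0 := by
      by_cases hi : i = i₀
      · rw [hi, h0]
      · exact h' i hi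
    rw [hcl] at this
    exact sub_eq_zero.1 this
  have h1 := LinearMap.finrank_le_finrank_of_injective hg
  rw [Module.finrank_fintype_fun_eq_card, Fintype.card_coe, Finset.card_erase_of_mem hi₀] at h1
  have := Finset.card_pos.2 ⟨i₀, hi₀⟩
  omega

open Classical in
lemma le_sum_card_carrier_sub_one {P : Set (EuclideanSpace ℝ (Fin n))} {ι : Type} [Fintype ι]
    (T : ι → AffineBasis (Fin (n + 1)) ℝ (EuclideanSpace ℝ (Fin n)))
    (hcov : P ⊆ ⋃ t, convexHull ℝ (Set.range (T t))) {p : EuclideanSpace ℝ (Fin n)}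
    (hp : p ∈ interior P) (hv : ∀ t i, T t i ≠ p) :
    n ≤ ∑ t with p ∈ convexHull ℝ (Set.range (T t)), ((carrier (T t) p).card - 1) := by
  by_contra! hlt
  set A := Finset.univ.filter fun t => p ∈ convexHull ℝ (Set.range (T t)) with hA
  have hmem : ∀ t ∈ A, p ∈ convexHull ℝ (Set.range (T t)) := fun t ht => by simpa [hA] using ht
  -- Since `p` is not a vertex, each of the other cells of `A` contributes at least 1 to a sum that
  -- is less than `n`.
  have hle : ∀ t ∈ A, (carrier (T t) p).card - 1 + A.card ≤ n := by
    intro t ht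
    have h1 := Finset.add_sum_erase A (fun t => (carrier (T t) p).card - 1) ht
    have h2 : (A.erase t).card • 1 ≤ ∑ s ∈ A.erase t, ((carrier (T s) p).card - 1) :=
      Finset.card_nsmul_le_sum _ _ _ fun s hs => by
        have := one_lt_card_carrier (hmem s (Finset.mem_of_mem_erase hs)) (hv s)
        omega
    rw [Finset.card_erase_of_mem ht] at h2
    simp only [smul_eq_mul, mul_one] at h2 h1
    omega
  -- Coordinates in the carrier are replaced by 0, so the negative one is a coordinate that vanishes
  -- at `p`: moving along `x` leaves every cell of `A` at once.
  obtain ⟨x, hx⟩ := exists_forall_exists_neg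
    (fun t (k : Fin (n + 1)) => if k ∈ carrier (T t) p then 0 else ((T t).coord k).linear) A
    (fun t => carrierDirection (T t) p)
    (fun t _ x hx => (Submodule.mem_iInf _).2 fun ⟨k, hk⟩ => by simpa [hk] using hx k)
    (fun t ht => by
      have h1 := finrank_carrierDirection_add_one_le (T t) p
      have h2 := hle t ht
      rw [finrank_euclideanSpace_fin]
      omega)
  have htend : Filter.Tendsto (fun ε : ℝ => p + ε • x) (nhdsWithin 0 (Set.Ioi 0)) (nhds p) := by
    have : Continuous fun ε : ℝ => p + ε • x := by fun_prop
    simpa using (this.tendsto 0).mono_left nhdsWithin_le_nhds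
  have hev1 := htend.eventually (mem_interior_iff_mem_nhds.1 hp)
  have hev2 : ∀ᶠ ε in nhdsWithin (0 : ℝ) (Set.Ioi 0),
      ∀ t, t ∉ A → p + ε • x ∉ convexHull ℝ (Set.range (T t)) := by
    refine Filter.eventually_all.2 fun t => ?_
    by_cases ht : t ∈ A
    · simp [ht]
    · have hcl : IsClosed (convexHull ℝ (Set.range (T t))) :=
        (Set.finite_range _).isClosed_convexHull ℝ
      filter_upwards [htend.eventually (hcl.isOpen_compl.mem_nhds (by simpa [hA] using ht))]
        with ε hε _ using hε
  obtain ⟨ε, ⟨h1, h2⟩, hε⟩ := ((hev1.and hev2).and self_mem_nhdsWithin).exists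
  obtain ⟨t, ht⟩ := Set.mem_iUnion.1 (hcov h1)
  have htA : t ∈ A := by
    by_contra h
    exact h2 t h ht
  obtain ⟨k, hk⟩ := hx t htA
  by_cases hkc : k ∈ carrier (T t) p
  · simp [hkc] at hk
  · have hk0 : (T t).coord k p ≤ 0 := not_lt.1 fun h => hkc (mem_carrier.2 h)
    simp only [hkc, if_false] at hk
    have h3 := mem_convexHull_affineBasis_iff.1 ht k
    have h4 : (T t).coord k (p + ε • x) = ε * ((T t).coord k).linear x + (T t).coord k p := by
      simpa [add_comm] using ((T t).coord k).map_vadd p (ε • x)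
    rw [h4] at h3
    nlinarith [mul_neg_of_pos_of_neg (Set.mem_Ioi.1 hε) hk]

lemma exists_refinement {P : Set (EuclideanSpace ℝ (Fin n))} {ι : Type} [Fintype ι]
    (T : ι → AffineBasis (Fin (n + 1)) ℝ (EuclideanSpace ℝ (Fin n)))
    (hcov : P ⊆ ⋃ t, convexHull ℝ (Set.range (T t))) {p : EuclideanSpace ℝ (Fin n)}
    (hp : p ∈ interior P) (hv : ∀ t i, T t i ≠ p) :
    ∃ (ι' : Type) (_ : Fintype ι')
      (T' : ι' → AffineBasis (Fin (n + 1)) ℝ (EuclideanSpace ℝ (Fin n))),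
      P ⊆ ⋃ t, convexHull ℝ (Set.range (T' t)) ∧
      ∑ t, |(vertexMatrix (T' t)).det| = ∑ t, |(vertexMatrix (T t)).det| ∧
      (∀ t i, T' t i = p ∨ ∃ s j, T' t i = T s j) ∧
      Fintype.card ι + n ≤ Fintype.card ι' := by
  classical
  choose S b hS hdet hb hcard using fun t => exists_star_subdivision (T t) p
  refine ⟨Σ t, S t, inferInstance, fun x => b x.1 x.2, fun x hx => ?_, ?_, ?_, ?_⟩
  · obtain ⟨t, ht⟩ := Set.mem_iUnion.1 (hcov hx)
    obtain ⟨i, hi, hxi⟩ := hS t x ht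
    exact Set.mem_iUnion.2 ⟨⟨t, i, hi⟩, hxi⟩
  · rw [Fintype.sum_sigma]
    refine Finset.sum_congr rfl fun t _ => ?_
    rw [← hdet t]
    exact Finset.sum_coe_sort (S t) fun i => |(vertexMatrix (b t i)).det|
  · exact fun x i => (hb x.1 x.2 i).imp_right fun h => ⟨x.1, i, h⟩
  · have h1 := le_sum_card_carrier_sub_one T hcov hp hv
    have h2 : Fintype.card (Σ t, S t) = ∑ t, (S t).card := by simp [Fintype.card_sigma]
    have h3 : ∑ t, (S t).card = ∑ t, (1 + if p ∈ convexHull ℝ (Set.range (T t)) then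
        (carrier (T t) p).card - 1 else 0) := by
      refine Finset.sum_congr rfl fun t _ => ?_
      rw [hcard t]
      split_ifs with h
      · have := one_lt_card_carrier h (hv t)
        omega
      · rfl
    rw [h2, h3, Finset.sum_add_distrib, ← Finset.sum_filter]
    simpa using h1

end EhrhartVolume

namespace EhrhartVolume

variable {n m : ℕ}

/-! ### Regular triangulations from generic heights -/

lemma det_vertexMatrix_ne_zero_of_affineIndependent
    {b : Fin (n + 1) → EuclideanSpace ℝ (Fin n)} (h : AffineIndependent ℝ b) :
    (vertexMatrix b).det ≠ 0 :=
  det_vertexMatrix_ne_zero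
    ⟨b, h, h.affineSpan_eq_top_iff_card_eq_finrank_add_one.2 (by simp)⟩

/-- The value at `v k` of the affine function that agrees with the heights `ω` on a simplex. -/
noncomputable def interpolate (v : Fin m → EuclideanSpace ℝ (Fin n)) (ω : Fin m → ℝ)
    (f : Fin (n + 1) → Fin m) (h : (vertexMatrix (v ∘ f)).det ≠ 0) (k : Fin m) : ℝ :=
  ∑ i, (affineBasisOfDet (v ∘ f) h).coord i (v k) * ω (f i)

/-- No height lies on the affine function spanned by the heights of other points. -/
def GenericHeights (v : Fin m → EuclideanSpace ℝ (Fin n)) (ω : Fin m → ℝ) : Prop :=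
  ∀ (f : Fin (n + 1) → Fin m) (h : (vertexMatrix (v ∘ f)).det ≠ 0) (k : Fin m),
    interpolate v ω f h k = ω k → k ∈ Set.range f

/-- Each forbidden coincidence is the vanishing of a linear functional in `ω`, nonzero because it
takes the value `-1` at the `k`-th unit vector. Finitely many hyperplanes do not cover the space. -/
lemma exists_genericHeights (v : Fin m → EuclideanSpace ℝ (Fin n)) :
    ∃ ω, GenericHeights v ω := by
  classical
  let κ := {x : (Fin (n + 1) → Fin m) × Fin m //
    (vertexMatrix (v ∘ x.1)).det ≠ 0 ∧ x.2 ∉ Set.range x.1}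
  let φ : κ → Module.Dual ℝ (Fin m → ℝ) := fun x =>
    (∑ i, (affineBasisOfDet (v ∘ x.1.1) x.2.1).coord i (v x.1.2) •
      LinearMap.proj (R := ℝ) (φ := fun _ => ℝ) (x.1.1 i)) - LinearMap.proj x.1.2
  obtain ⟨ω, hω⟩ := Module.Dual.exists_forall_ne_zero_of_forall_exists φ (fun x => by
    refine ⟨Pi.single x.1.2 1, ?_⟩
    have : ∀ i, (Pi.single x.1.2 1 : Fin m → ℝ) (x.1.1 i) = 0 := fun i =>
      Pi.single_eq_of_ne (fun h => x.2.2 ⟨i, h⟩) _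
    simp [φ, this])
  refine ⟨ω, fun f h k hk => ?_⟩
  by_contra hkf
  refine hω ⟨(f, k), h, hkf⟩ ?_
  simpa [φ, interpolate, sub_eq_zero] using hk

/-- The simplices of the regular subdivision of the points `v` defined by the heights `ω`. -/
def RegularCell (v : Fin m → EuclideanSpace ℝ (Fin n)) (ω : Fin m → ℝ) : Type :=
  {f : Fin (n + 1) ↪o Fin m // ∃ h : (vertexMatrix (v ∘ f)).det ≠ 0,
    ∀ k, interpolate v ω f h k ≤ ω k}

noncomputable instance (v : Fin m → EuclideanSpace ℝ (Fin n)) (ω : Fin m → ℝ) :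
    Fintype (RegularCell v ω) := by
  classical
  haveI : Finite (Fin (n + 1) ↪o Fin m) := Finite.of_injective _ DFunLike.coe_injective
  exact Fintype.ofFinite {f : Fin (n + 1) ↪o Fin m // ∃ h : (vertexMatrix (v ∘ f)).det ≠ 0,
    ∀ k, interpolate v ω f h k ≤ ω k}

namespace RegularCell

variable {v : Fin m → EuclideanSpace ℝ (Fin n)} {ω : Fin m → ℝ}

/-- The vertices of a cell. -/
noncomputable def basis (c : RegularCell v ω) :
    AffineBasis (Fin (n + 1)) ℝ (EuclideanSpace ℝ (Fin n)) :=
  affineBasisOfDet (v ∘ c.1) c.2.choose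

lemma coe_basis (c : RegularCell v ω) : ⇑c.basis = v ∘ c.1 := rfl

lemma sum_coord_mul_le (c : RegularCell v ω) (k : Fin m) :
    ∑ i, c.basis.coord i (v k) * ω (c.1 i) ≤ ω k :=
  c.2.choose_spec k

lemma sum_coord_mul_coord (c c' : RegularCell v ω) (x : EuclideanSpace ℝ (Fin n))
    (j : Fin (n + 1)) :
    ∑ i, c.basis.coord i x * c'.basis.coord j (v (c.1 i)) = c'.basis.coord j x := by
  simpa [Matrix.vecMul, dotProduct, AffineBasis.toMatrix_apply, coe_basis] using
    congrFun (c'.basis.toMatrix_vecMul_coords c.basis x) j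

/-- The interpolant of `c'` is affine, so averaging its values at the vertices of `c` gives its
value at `x`. -/
lemma sum_coord_mul_sum (c c' : RegularCell v ω) (x : EuclideanSpace ℝ (Fin n)) :
    ∑ i, c.basis.coord i x * ∑ j, c'.basis.coord j (v (c.1 i)) * ω (c'.1 j)
      = ∑ j, c'.basis.coord j x * ω (c'.1 j) := by
  simp_rw [Finset.mul_sum, ← sum_coord_mul_coord c c' x, Finset.sum_mul]
  rw [Finset.sum_comm]
  simp_rw [mul_assoc]

/-- Both interpolants lie below the heights, so at a common point `x` each is at most the other.
Equality with positive weights forces the interpolant of `c'` to attain the height at every vertex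
of `c`, and genericity makes these vertices of `c'`. -/
lemma range_subset_of_mem_interior (hω : GenericHeights v ω) (c c' : RegularCell v ω)
    {x : EuclideanSpace ℝ (Fin n)} (hx : ∀ i, 0 < c.basis.coord i x)
    (hx' : ∀ i, 0 < c'.basis.coord i x) : Set.range c.1 ⊆ Set.range c'.1 := by
  have h1 : ∀ i ∈ Finset.univ, c.basis.coord i x * ∑ j, c'.basis.coord j (v (c.1 i)) * ω (c'.1 j)
      ≤ c.basis.coord i x * ω (c.1 i) := fun i _ =>
    mul_le_mul_of_nonneg_left (c'.sum_coord_mul_le _) (hx i).le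
  have h2 : ∑ i, c'.basis.coord i x * ∑ j, c.basis.coord j (v (c'.1 i)) * ω (c.1 j)
      ≤ ∑ i, c'.basis.coord i x * ω (c'.1 i) := Finset.sum_le_sum fun i _ =>
    mul_le_mul_of_nonneg_left (c.sum_coord_mul_le _) (hx' i).le
  have h3 := Finset.sum_le_sum h1
  rw [sum_coord_mul_sum] at h2 h3
  have h4 := (Finset.sum_eq_sum_iff_of_le h1).1
    (by rw [sum_coord_mul_sum]; exact le_antisymm h3 h2)
  rintro _ ⟨i, rfl⟩
  refine hω c'.1 c'.2.choose (c.1 i) ?_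
  exact mul_left_cancel₀ (hx i).ne' (h4 i (Finset.mem_univ i))

lemma disjoint_interior (hω : GenericHeights v ω) {c c' : RegularCell v ω} (h : c ≠ c') :
    Disjoint (interior (convexHull ℝ (Set.range c.basis)))
      (interior (convexHull ℝ (Set.range c'.basis))) := by
  rw [Set.disjoint_left]
  intro x hx hx'
  rw [AffineBasis.interior_convexHull] at hx hx'
  -- Cells are increasing lists, so the vertex set determines the cell.
  refine h (Subtype.ext (OrderEmbedding.range_inj.1 (subset_antisymm ?_ ?_)))
  · exact range_subset_of_mem_interior hω c c' hx hx'
  · exact range_subset_of_mem_interior hω c' c hx' hx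

lemma convexHull_subset (c : RegularCell v ω) :
    convexHull ℝ (Set.range c.basis) ⊆ convexHull ℝ (Set.range v) :=
  convexHull_mono (by rw [coe_basis]; exact Set.range_comp_subset_range _ _)

lemma sum_abs_det_le (hω : GenericHeights v ω) :
    ∑ c : RegularCell v ω, |(vertexMatrix c.basis).det|
      ≤ n.factorial * (volume (convexHull ℝ (Set.range v))).toReal := by
  have hfin : volume (convexHull ℝ (Set.range v)) ≠ ⊤ :=
    ((Set.finite_range v).isCompact_convexHull ℝ).measure_lt_top.ne
  have h1 : ∀ c : RegularCell v ω, volume (interior (convexHull ℝ (Set.range c.basis)))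
      = ENNReal.ofReal (|(vertexMatrix c.basis).det| / n.factorial) := by
    intro c
    rw [← volume_convexHull_range]
    exact measure_congr (interior_ae_eq_of_null_frontier
      ((convex_convexHull ℝ _).addHaar_frontier volume))
  have h2 : ∑ c : RegularCell v ω, volume (interior (convexHull ℝ (Set.range c.basis)))
      ≤ volume (convexHull ℝ (Set.range v)) := by
    rw [← tsum_fintype (L := .unconditional _), ← measure_iUnion (fun c c' h => disjoint_interior hω h)
      fun c => isOpen_interior.measurableSet]
    exact measure_mono (Set.iUnion_subset fun c => interior_subset.trans c.convexHull_subset)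
  simp_rw [h1] at h2
  rw [← ENNReal.ofReal_sum_of_nonneg fun c _ => by positivity, ← Finset.sum_div,
    ENNReal.ofReal_le_iff_le_toReal hfin, div_le_iff₀' (by positivity)] at h2
  exact h2

end RegularCell

/-- A linear program on a compact set attains its minimum; the last clause says that no feasible
direction `μ` lowers the cost. -/
lemma exists_min_weights (v : Fin m → EuclideanSpace ℝ (Fin n)) (ω : Fin m → ℝ)
    {x : EuclideanSpace ℝ (Fin n)} (hx : x ∈ convexHull ℝ (Set.range v)) :
    ∃ w : Fin m → ℝ, (∀ k, 0 ≤ w k) ∧ ∑ k, w k = 1 ∧ ∑ k, w k • v k = x ∧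
      ∀ μ : Fin m → ℝ, ∑ k, μ k = 0 → ∑ k, μ k • v k = 0 → (∀ k, w k = 0 → 0 ≤ μ k) →
        0 ≤ ∑ k, μ k * ω k := by
  have hK : IsCompact (stdSimplex ℝ (Fin m) ∩ {w | ∑ k, w k • v k = x}) :=
    (isCompact_stdSimplex ℝ (Fin m)).inter_right (isClosed_eq (by fun_prop) continuous_const)
  obtain ⟨w₀, h0, h1, h2⟩ := mem_convexHull_range_iff.1 hx
  obtain ⟨w, ⟨⟨hw0, hw1⟩, hw2⟩, hmin⟩ := hK.exists_isMinOn ⟨w₀, ⟨h0, h1⟩, h2⟩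
    (f := fun w => ∑ k, w k * ω k) (by fun_prop)
  refine ⟨w, hw0, hw1, hw2, fun μ hμ1 hμ2 hμ0 => ?_⟩
  have hev : ∀ᶠ ε in nhdsWithin (0 : ℝ) (Set.Ioi 0), ∀ k, 0 ≤ w k + ε * μ k := by
    refine Filter.eventually_all.2 fun k => ?_
    rcases (hw0 k).eq_or_lt with h | h
    · filter_upwards [self_mem_nhdsWithin] with ε hε
      rw [← h, zero_add]
      exact mul_nonneg (le_of_lt hε) (hμ0 k h.symm)
    · have hc : Continuous fun ε : ℝ => w k + ε * μ k := by fun_prop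
      have : ∀ᶠ ε in nhds (0 : ℝ), 0 < w k + ε * μ k :=
        (hc.tendsto 0).eventually (lt_mem_nhds (by simpa using h))
      exact (this.filter_mono nhdsWithin_le_nhds).mono fun ε hε => hε.le
  obtain ⟨ε, h, hε⟩ := (hev.and self_mem_nhdsWithin).exists
  have h3 := hmin (a := fun k => w k + ε * μ k) ⟨⟨h, ?_⟩, ?_⟩
  · simp only [Set.mem_ofPred_eq, add_mul, Finset.sum_add_distrib, mul_assoc, ← Finset.mul_sum] at h3
    have h3 : 0 ≤ ε * ∑ k, μ k * ω k := by linarith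
    exact nonneg_of_mul_nonneg_right h3 hε
  · rw [Finset.sum_add_distrib, hw1, ← Finset.mul_sum, hμ1, mul_zero, add_zero]
  · simp only [Set.mem_ofPred_eq] at hw2 ⊢
    simp only [add_smul, mul_smul, Finset.sum_add_distrib, ← Finset.smul_sum, hw2, hμ2, smul_zero,
      add_zero]

lemma exists_orderEmbedding_of_affineSpan_eq_top (v : Fin m → EuclideanSpace ℝ (Fin n))
    (S : Set (Fin m)) (hS : affineSpan ℝ (v '' S) = ⊤) :
    ∃ f : Fin (n + 1) ↪o Fin m, (∀ i, f i ∈ S) ∧ (vertexMatrix (v ∘ f)).det ≠ 0 := by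
  classical
  obtain ⟨s, hs, b, hb⟩ := AffineBasis.exists_affine_subbasis hS
  choose g hg using fun y : s => hs y.2
  have hsfin : Finite s := ((Set.toFinite S).image v).subset hs
  have := Fintype.ofFinite s
  have hginj : Function.Injective g := fun y z h => by
    rw [Subtype.ext_iff, ← (hg y).2, ← (hg z).2, h]
  have hcard : (Finset.univ.image g).card = n + 1 := by
    rw [Finset.card_image_of_injective _ hginj, Finset.card_univ,
      b.card_eq_finrank_add_one, finrank_euclideanSpace_fin]
  let f := (Finset.univ.image g).orderEmbOfFin hcard
  have hf : ∀ i, ∃ y, g y = f i := fun i => by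
    obtain ⟨y, -, hy⟩ := Finset.mem_image.1 ((Finset.univ.image g).orderEmbOfFin_mem hcard i)
    exact ⟨y, hy⟩
  choose σ hσ using hf
  refine ⟨f, fun i => hσ i ▸ (hg _).1, det_vertexMatrix_ne_zero_of_affineIndependent ?_⟩
  have hσinj : Function.Injective σ := fun i j h => f.injective (by rw [← hσ, ← hσ, h])
  have hv : v ∘ f = b ∘ (⟨σ, hσinj⟩ : Fin (n + 1) ↪ s) := by
    ext1 i
    simp only [Function.comp_apply, Function.Embedding.coeFn_mk, hb]
    rw [← hσ, (hg _).2]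
  rw [hv]
  exact b.ind.comp_embedding _

/-- The support of an optimal weight affinely spans the space by `hgen`, hence contains a basis `f`.
Optimality puts the interpolant of `f` below all heights, with equality on the support, so by
genericity the support lies in `f`. -/
lemma exists_regularCell_of_generic {v : Fin m → EuclideanSpace ℝ (Fin n)} {ω : Fin m → ℝ}
    (hω : GenericHeights v ω) {x : EuclideanSpace ℝ (Fin n)} (hx : x ∈ convexHull ℝ (Set.range v))
    (hgen : ∀ S : Set (Fin m), x ∈ affineSpan ℝ (v '' S) → affineSpan ℝ (v '' S) = ⊤) :
    ∃ c : RegularCell v ω, x ∈ convexHull ℝ (Set.range c.basis) := by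
  classical
  obtain ⟨w, hw0, hw1, hw2, hw⟩ := exists_min_weights v ω hx
  set S : Set (Fin m) := {k | w k ≠ 0} with hSdef
  have hxS : x ∈ affineSpan ℝ (v '' S) := by
    rw [← hw2, ← Finset.univ.affineCombination_eq_linear_combination v w hw1]
    refine affineCombination_mem_affineSpan_image hw1 ?_ _
    intro k _ hk
    simpa [hSdef] using hk
  obtain ⟨f, hfS, hdet⟩ := exists_orderEmbedding_of_affineSpan_eq_top v S (hgen S hxS)
  set b := affineBasisOfDet (v ∘ f) hdet with hb
  -- Reduced cost: `μ` puts weight 1 on `k₀` and removes the affine expression of `v k₀` in the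
  -- basis.
  have hμ : ∀ k₀, ∃ μ : Fin m → ℝ, ∑ k, μ k = 0 ∧ ∑ k, μ k • v k = 0 ∧
      ∑ k, μ k * ω k = ω k₀ - interpolate v ω f hdet k₀ ∧
      ∀ k, w k = 0 → μ k = if k = k₀ then 1 else 0 := by
    intro k₀
    have key : ∀ {F : Type} [AddCommGroup F] [Module ℝ F] (g : Fin m → F),
        ∑ k, ((if k = k₀ then 1 else 0) - ∑ i, if f i = k then b.coord i (v k₀) else 0) • g k
          = g k₀ - ∑ i, b.coord i (v k₀) • g (f i) := by
      intro F _ _ g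
      simp_rw [sub_smul, Finset.sum_smul]
      rw [Finset.sum_sub_distrib, Finset.sum_comm]
      simp [ite_smul]
    refine ⟨fun k => (if k = k₀ then 1 else 0) - ∑ i, if f i = k then b.coord i (v k₀) else 0,
      ?_, ?_, ?_, ?_⟩
    · simpa [b.sum_coord_apply_eq_one] using key fun _ => (1 : ℝ)
    · have := b.linear_combination_coord_eq_self (v k₀)
      rw [key v, sub_eq_zero]
      exact this.symm
    · simpa only [smul_eq_mul, interpolate] using key ω
    · intro k hk
      have : ∀ i, f i ≠ k := fun i h => hfS i (h ▸ hk)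
      simp [this]
  have hle : ∀ k, interpolate v ω f hdet k ≤ ω k := by
    intro k
    obtain ⟨μ, h1, h2, h3, h4⟩ := hμ k
    have := hw μ h1 h2 fun k hk => by rw [h4 k hk]; split_ifs <;> norm_num
    linarith
  -- On the support the direction can also be reversed.
  have hrange : ∀ k, w k ≠ 0 → k ∈ Set.range f := by
    intro k hk
    obtain ⟨μ, h1, h2, h3, h4⟩ := hμ k
    have := hw (-μ) (by simpa using h1) (by simpa using h2) fun j hj => by
      have : j ≠ k := fun h => hk (h ▸ hj)
      simp [h4 j hj, this]
    simp only [Pi.neg_apply, neg_mul, Finset.sum_neg_distrib, h3] at this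
    exact hω f hdet k (le_antisymm (hle k) (by linarith))
  have hsum : ∀ {F : Type} [AddCommGroup F] [Module ℝ F] (g : Fin m → F),
      ∑ i, w (f i) • g (f i) = ∑ k, w k • g k := by
    intro F _ _ g
    refine Fintype.sum_of_injective f f.injective _ _ (fun k hk => ?_) fun _ => rfl
    have : w k = 0 := by
      by_contra h
      exact hk (hrange k h)
    rw [this, zero_smul]
  refine ⟨⟨f, hdet, hle⟩, mem_convexHull_range_iff.2 ⟨fun i => w (f i), fun i => hw0 _, ?_, ?_⟩⟩
  · simpa [hw1] using hsum fun _ => (1 : ℝ)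
  · rw [← hw2]
    exact hsum v

/-- Points on no proper affine span of a subset of `v` have full measure, hence are dense. The union
of cells is closed, so covering them covers the interior and then its closure. -/
lemma convexHull_subset_iUnion_regularCell {v : Fin m → EuclideanSpace ℝ (Fin n)} {ω : Fin m → ℝ}
    (hω : GenericHeights v ω) (hv : affineSpan ℝ (Set.range v) = ⊤) :
    convexHull ℝ (Set.range v) ⊆ ⋃ c : RegularCell v ω, convexHull ℝ (Set.range c.basis) := by
  set U := ⋃ c : RegularCell v ω, convexHull ℝ (Set.range c.basis)
  have hU : IsClosed U := isClosed_iUnion_of_finite fun c => (Set.finite_range _).isClosed_convexHull ℝ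
  have hae : ∀ᵐ x : EuclideanSpace ℝ (Fin n), ∀ S : Set (Fin m),
      x ∈ affineSpan ℝ (v '' S) → affineSpan ℝ (v '' S) = ⊤ := by
    refine ae_all_iff.2 fun S => ?_
    by_cases hS : affineSpan ℝ (v '' S) = ⊤
    · simp [hS]
    · have := Measure.addHaar_affineSubspace volume _ hS
      filter_upwards [compl_mem_ae_iff.2 this] with x hx hx'
      exact absurd hx' hx
  have hdense := Measure.dense_of_ae hae
  have hint : interior (convexHull ℝ (Set.range v)) ⊆ U := by
    have h1 := hdense.open_subset_closure_inter (isOpen_interior (s := convexHull ℝ (Set.range v)))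
    refine h1.trans (closure_minimal ?_ hU)
    rintro x ⟨hx, hgen⟩
    exact Set.mem_iUnion.2 (exists_regularCell_of_generic hω (interior_subset hx) hgen)
  have hne := interior_convexHull_nonempty_iff_affineSpan_eq_top.2 hv
  calc _ ⊆ closure (convexHull ℝ (Set.range v)) := subset_closure
    _ = closure (interior (convexHull ℝ (Set.range v))) :=
      ((convex_convexHull ℝ _).closure_interior_eq_closure_of_nonempty_interior hne).symm
    _ ⊆ U := closure_minimal hint hU

/-- A polytope has a dissection into simplices with vertices in a given finite set. -/
lemma exists_dissection {V : Set (EuclideanSpace ℝ (Fin n))} (hV : V.Finite)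
    (hspan : affineSpan ℝ V = ⊤) :
    ∃ (ι : Type) (_ : Fintype ι)
      (T : ι → AffineBasis (Fin (n + 1)) ℝ (EuclideanSpace ℝ (Fin n))),
      (∀ t i, T t i ∈ V) ∧
      convexHull ℝ V ⊆ ⋃ t, convexHull ℝ (Set.range (T t)) ∧
      ∑ t, |(vertexMatrix (T t)).det| ≤ n.factorial * (volume (convexHull ℝ V)).toReal := by
  obtain ⟨m, v, rfl⟩ : ∃ (m : ℕ) (v : Fin m → EuclideanSpace ℝ (Fin n)), Set.range v = V := by
    have := hV.fin_param
    obtain ⟨m, v, -, h⟩ := this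
    exact ⟨m, v, h⟩
  obtain ⟨ω, hω⟩ := exists_genericHeights v
  exact ⟨RegularCell v ω, inferInstance, RegularCell.basis, fun c i => ⟨c.1 i, rfl⟩,
    convexHull_subset_iUnion_regularCell hω hspan, RegularCell.sum_abs_det_le hω⟩

/-! ### Lattice polytopes and the volume bound -/

namespace IsLatticePolytope

variable {P : Set (EuclideanSpace ℝ (Fin n))}

lemma isCompact (hP : IsLatticePolytope P) : IsCompact P := by
  obtain ⟨V, hV, rfl⟩ := hP.polytope
  exact hV.isCompact_convexHull ℝ

lemma finite_extremePoints (hP : IsLatticePolytope P) : (P.extremePoints ℝ).Finite := by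
  obtain ⟨V, hV, rfl⟩ := hP.polytope
  exact hV.subset extremePoints_convexHull_subset

lemma convexHull_extremePoints (hP : IsLatticePolytope P) :
    convexHull ℝ (P.extremePoints ℝ) = P := by
  have hconv : Convex ℝ P := by
    obtain ⟨V, hV, rfl⟩ := hP.polytope
    exact convex_convexHull ℝ V
  rw [← (hP.finite_extremePoints.isClosed_convexHull ℝ).closure_eq,
    closure_convexHull_extremePoints hP.isCompact hconv]

lemma affineSpan_extremePoints (hP : IsLatticePolytope P) :
    affineSpan ℝ (P.extremePoints ℝ) = ⊤ := by
  rw [← affineSpan_convexHull, hP.convexHull_extremePoints, hP.fullDim]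

end IsLatticePolytope

lemma exists_refinement_finset {P : Set (EuclideanSpace ℝ (Fin n))}
    {V : Set (EuclideanSpace ℝ (Fin n))} {ι : Type} [Fintype ι]
    (T : ι → AffineBasis (Fin (n + 1)) ℝ (EuclideanSpace ℝ (Fin n))) (hT : ∀ t i, T t i ∈ V)
    (hcov : P ⊆ ⋃ t, convexHull ℝ (Set.range (T t))) (S : Finset (EuclideanSpace ℝ (Fin n)))
    (hS : ∀ p ∈ S, p ∈ interior P ∧ p ∉ V) :
    ∃ (ι' : Type) (_ : Fintype ι')
      (T' : ι' → AffineBasis (Fin (n + 1)) ℝ (EuclideanSpace ℝ (Fin n))),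
      P ⊆ ⋃ t, convexHull ℝ (Set.range (T' t)) ∧
      ∑ t, |(vertexMatrix (T' t)).det| = ∑ t, |(vertexMatrix (T t)).det| ∧
      (∀ t i, T' t i ∈ V ∨ T' t i ∈ S) ∧
      Fintype.card ι + n * S.card ≤ Fintype.card ι' := by
  classical
  induction S using Finset.induction_on with
  | empty => exact ⟨ι, inferInstance, T, hcov, rfl, fun t i => Or.inl (hT t i), by simp⟩
  | insert p S hp ih =>
    obtain ⟨ι₁, _, T₁, hcov₁, hdet₁, hT₁, hcard₁⟩ :=
      ih fun q hq => hS q (Finset.mem_insert_of_mem hq)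
    obtain ⟨hpP, hpV⟩ := hS p (Finset.mem_insert_self _ _)
    obtain ⟨ι₂, _, T₂, hcov₂, hdet₂, hT₂, hcard₂⟩ := exists_refinement T₁ hcov₁ hpP
      fun t i h => (hT₁ t i).elim (fun h' => hpV (h ▸ h')) fun h' => hp (h ▸ h')
    refine ⟨ι₂, inferInstance, T₂, hcov₂, hdet₂.trans hdet₁, fun t i => ?_, ?_⟩
    · rcases hT₂ t i with h | ⟨s, j, h⟩
      · exact Or.inr (h ▸ Finset.mem_insert_self _ _)
      · rw [h]
        exact (hT₁ s j).imp_right Finset.mem_insert_of_mem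
    · rw [Finset.card_insert_of_notMem hp, mul_add, mul_one]
      omega

/-- A lattice polytope has a dissection into simplices spanned by its vertices, and the number of
its cells bounds the volume even after subdividing at interior lattice points. -/
lemma IsLatticePolytope.exists_dissection_card_add_le (hn : 1 ≤ n)
    {P : Set (EuclideanSpace ℝ (Fin n))} (hP : IsLatticePolytope P) :
    ∃ (ι : Type) (_ : Fintype ι)
      (T : ι → AffineBasis (Fin (n + 1)) ℝ (EuclideanSpace ℝ (Fin n))),
      (∀ t i, T t i ∈ P.extremePoints ℝ) ∧
      P ⊆ ⋃ t, convexHull ℝ (Set.range (T t)) ∧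
      0 < Fintype.card ι ∧
      ∀ S : Finset (EuclideanSpace ℝ (Fin n)), (∀ p ∈ S, p ∈ interior P ∧ IsLatticePoint p) →
        (Fintype.card ι : ℝ) + n * S.card ≤ n.factorial * (volume P).toReal := by
  obtain ⟨ι, _, T, hT, hcov, hdet⟩ :=
    exists_dissection hP.finite_extremePoints hP.affineSpan_extremePoints
  rw [hP.convexHull_extremePoints] at hcov hdet
  refine ⟨ι, inferInstance, T, hT, hcov, ?_, fun S hS => ?_⟩
  · obtain ⟨x, hx⟩ : P.Nonempty := by
      by_contra h
      have := hP.fullDim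
      rw [Set.not_nonempty_iff_eq_empty.1 h, AffineSubspace.span_empty] at this
      exact bot_ne_top this
    obtain ⟨t, -⟩ := Set.mem_iUnion.1 (hcov hx)
    exact Fintype.card_pos_iff.2 ⟨t⟩
  · have : Nonempty (Fin n) := ⟨⟨0, hn⟩⟩
    obtain ⟨ι', _, T', -, hdet', hT', hcard⟩ := exists_refinement_finset T hT hcov S
      fun p hp => ⟨(hS p hp).1,
        Set.disjoint_left.1 (disjoint_interior_extremePoints P) (hS p hp).1⟩
    have hlat : ∀ t i, IsLatticePoint (T' t i) := fun t i =>
      (hT' t i).elim (hP.vertices _) fun h => (hS _ h).2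
    calc (Fintype.card ι : ℝ) + n * S.card ≤ Fintype.card ι' := by exact_mod_cast hcard
      _ = ∑ t : ι', (1 : ℝ) := by simp
      _ ≤ ∑ t, |(vertexMatrix (T' t)).det| := Finset.sum_le_sum fun t _ =>
          one_le_abs_det_vertexMatrix (hlat t) (det_vertexMatrix_ne_zero _)
      _ ≤ _ := hdet'.trans_le hdet

lemma IsLatticePolytope.le_volume (hn : 1 ≤ n) {P : Set (EuclideanSpace ℝ (Fin n))}
    (hP : IsLatticePolytope P) :
    ((n : ℝ) * latticeCount (interior P) + 1) / n.factorial ≤ (volume P).toReal := by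
  obtain ⟨ι, _, T, -, -, hpos, h⟩ := hP.exists_dissection_card_add_le hn
  obtain ⟨S, hS, hcard⟩ : ∃ S : Finset (EuclideanSpace ℝ (Fin n)),
      (∀ p ∈ S, p ∈ interior P ∧ IsLatticePoint p) ∧ S.card = latticeCount (interior P) := by
    by_cases hfin : {x | x ∈ interior P ∧ IsLatticePoint x}.Finite
    · exact ⟨hfin.toFinset, fun p hp => hfin.mem_toFinset.1 hp,
        (Set.ncard_eq_toFinset_card _ hfin).symm⟩
    -- An infinite set has `ncard` 0, so no finiteness proof is needed.
    · exact ⟨∅, by simp, (Set.Infinite.ncard hfin).symm⟩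
  have h1 := h S hS
  rw [hcard] at h1
  have h2 : (1 : ℝ) ≤ Fintype.card ι := by exact_mod_cast hpos
  rw [div_le_iff₀' (by positivity)]
  linarith

/-! ### The simplices `simplexS n l` -/

/-- A vertex list of the simplex `simplexS n l`. -/
noncomputable def simplexVertex (n l : ℕ) : Fin (n + 1) → EuclideanSpace ℝ (Fin n) :=
  Fin.cons (-((l : ℝ) • ∑ i : Fin n, EuclideanSpace.single i (1 : ℝ)))
    fun i => EuclideanSpace.single i 1

lemma simplexS_eq (n l : ℕ) : simplexS n l = convexHull ℝ (Set.range (simplexVertex n l)) := by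
  rw [simplexVertex, Fin.range_cons, simplexS]

lemma det_vertexMatrix_simplexVertex (n l : ℕ) :
    (vertexMatrix (simplexVertex n l)).det = n * l + 1 := by
  -- The edge matrix is a rank-one perturbation of the identity.
  have : (Matrix.of fun i j : Fin n => simplexVertex n l i.succ j - simplexVertex n l 0 j)
      = 1 + Matrix.replicateCol Unit (fun _ : Fin n => (l : ℝ)) *
        Matrix.replicateRow Unit (fun _ : Fin n => (1 : ℝ)) := by
    ext i j
    simp [simplexVertex, Matrix.one_apply, Matrix.mul_apply, Pi.single_apply, eq_comm]
  rw [det_vertexMatrix, this, Matrix.det_one_add_replicateCol_mul_replicateRow]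
  simp [dotProduct]
  ring

/-- The vertices of `simplexS n l` as an affine basis. -/
noncomputable def simplexBasis (n l : ℕ) :
    AffineBasis (Fin (n + 1)) ℝ (EuclideanSpace ℝ (Fin n)) :=
  affineBasisOfDet (simplexVertex n l) (by
    rw [det_vertexMatrix_simplexVertex]
    positivity)

lemma coe_simplexBasis (n l : ℕ) : ⇑(simplexBasis n l) = simplexVertex n l := rfl

lemma isLatticePoint_simplexVertex (n l : ℕ) (i : Fin (n + 1)) :
    IsLatticePoint (simplexVertex n l i) := by
  refine Fin.cases ⟨fun _ => -l, fun j => ?_⟩ (fun i => ⟨Pi.single i 1, fun j => ?_⟩) i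
  · simp [simplexVertex, Finset.sum_apply]
  · by_cases h : j = i
    · subst h
      simp [simplexVertex]
    · simp [simplexVertex, h]

lemma isLatticePolytope_simplexS (n l : ℕ) : IsLatticePolytope (simplexS n l) where
  polytope := ⟨_, Set.finite_range _, simplexS_eq n l⟩
  vertices v hv := by
    rw [simplexS_eq] at hv
    obtain ⟨i, rfl⟩ := extremePoints_convexHull_subset hv
    exact isLatticePoint_simplexVertex n l i
  fullDim := by
    rw [simplexS_eq, affineSpan_convexHull, ← coe_simplexBasis, AffineBasis.tot]

lemma volume_simplexS (n l : ℕ) :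
    (volume (simplexS n l)).toReal = ((n : ℝ) * l + 1) / n.factorial := by
  rw [simplexS_eq, volume_convexHull_range, det_vertexMatrix_simplexVertex,
    ENNReal.toReal_ofReal (by positivity), abs_of_nonneg (by positivity)]

lemma mem_interior_simplexS_iff {l : ℕ} {x : EuclideanSpace ℝ (Fin n)} :
    x ∈ interior (simplexS n l) ↔
      0 < 1 - ∑ i, x i ∧ ∀ i, 0 < x i * (n * l + 1) + l * (1 - ∑ i, x i) := by
  set s := 1 - ∑ i, x i with hs
  have hpos : (0 : ℝ) < n * l + 1 := by positivity
  -- The barycentric coordinates of `x`, obtained by solving for the weight of the vertex `-l ∑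
  -- e_i`.
  set w : Fin (n + 1) → ℝ := Fin.cons (s / (n * l + 1)) fun i => x i + l * (s / (n * l + 1)) with hw
  have hw1 : ∑ i, w i = 1 := by
    simp only [hw, Fin.sum_univ_succ, Fin.cons_zero, Fin.cons_succ, Finset.sum_add_distrib,
      Finset.sum_const, Finset.card_univ, Fintype.card_fin, nsmul_eq_mul]
    have : s / (n * l + 1) + n * (l * (s / (n * l + 1))) = s := by field_simp; ring
    linarith
  have hwx : ∑ i, w i • simplexVertex n l i = x := by
    ext j
    simp [hw, Fin.sum_univ_succ, simplexVertex, Finset.sum_apply, Pi.single_apply]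
    ring
  have hcoord : ∀ i, (simplexBasis n l).coord i x = w i := by
    intro i
    rw [← (simplexBasis n l).coord_apply_combination_of_mem (Finset.mem_univ i) hw1,
      Finset.affineCombination_eq_linear_combination _ _ _ hw1, coe_simplexBasis, hwx]
  rw [simplexS_eq, ← coe_simplexBasis, AffineBasis.interior_convexHull]
  simp only [Set.mem_ofPred_eq, hcoord, Fin.forall_fin_succ, hw, Fin.cons_zero, Fin.cons_succ]
  refine and_congr (div_pos_iff_of_pos_right hpos) (forall_congr' fun i => ?_)
  have : x i + l * (s / (n * l + 1)) = (x i * (n * l + 1) + l * s) / (n * l + 1) := by field_simp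
  rw [this, div_pos_iff_of_pos_right hpos]

lemma latticePoint_interior_simplexS_iff (hn : 1 ≤ n) (l : ℕ) (x : EuclideanSpace ℝ (Fin n)) :
    x ∈ interior (simplexS n l) ∧ IsLatticePoint x ↔
      ∃ c : ℕ, c < l ∧ x = WithLp.toLp 2 fun _ => (-(c : ℝ)) := by
  rw [mem_interior_simplexS_iff]
  constructor
  · rintro ⟨⟨h0, h1⟩, z, hz⟩
    simp only [hz] at h0 h1
    have h0' : 0 < 1 - ∑ i, z i := by exact_mod_cast h0
    have h1' : ∀ i, 0 < z i * (n * l + 1) + l * (1 - ∑ i, z i) := fun i => by exact_mod_cast h1 i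
    have : Nonempty (Fin n) := ⟨⟨0, hn⟩⟩
    obtain ⟨i₀, hi₀⟩ := Finite.exists_min z
    have hsum : n * z i₀ ≤ ∑ i, z i := by
      simpa using Finset.card_nsmul_le_sum Finset.univ z (z i₀) fun i _ => hi₀ i
    have hn' : (1 : ℤ) ≤ n := by exact_mod_cast hn
    have hl : (0 : ℤ) ≤ l := by positivity
    have hz0 : z i₀ ≤ 0 := by
      by_contra! h
      nlinarith
    have hkey := h1' i₀
    -- If the sum exceeded `n * z i₀` by 1 or more, `hkey` would give `0 < z i₀`. So all coordinates
    -- are equal.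
    have heq : ∑ i, z i = n * z i₀ := by
      refine le_antisymm ?_ hsum
      by_contra! h
      nlinarith [mul_le_mul_of_nonneg_left (Int.add_one_le_iff.2 h) hl]
    have hall : ∀ i, z i = z i₀ := by
      have : ∑ i, (z i - z i₀) = 0 := by simp [heq]
      intro i
      have := (Finset.sum_eq_zero_iff_of_nonneg fun i _ => sub_nonneg.2 (hi₀ i)).1 this i
        (Finset.mem_univ i)
      linarith
    rw [heq] at hkey
    have hlt : -z i₀ < l := by nlinarith
    refine ⟨(-z i₀).toNat, by omega, ?_⟩
    ext i
    have : ((-z i₀).toNat : ℤ) = -z i₀ := Int.toNat_of_nonneg (by omega)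
    have : (((-z i₀).toNat : ℕ) : ℝ) = -z i₀ := by exact_mod_cast this
    rw [hz, hall]
    simp [this]
  · rintro ⟨c, hc, rfl⟩
    refine ⟨⟨?_, fun i => ?_⟩, fun _ => -c, fun i => by simp⟩
    · simp
      positivity
    · have : (c : ℝ) < l := by exact_mod_cast hc
      simp
      nlinarith

lemma latticeCount_interior_simplexS (hn : 1 ≤ n) (l : ℕ) :
    latticeCount (interior (simplexS n l)) = l := by
  have h : {x | x ∈ interior (simplexS n l) ∧ IsLatticePoint x}
      = (fun c : ℕ => WithLp.toLp 2 fun _ : Fin n => (-(c : ℝ))) '' Finset.range l := by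
    ext x
    simp only [Set.mem_ofPred_eq, latticePoint_interior_simplexS_iff hn, Set.mem_image,
      Finset.coe_range, Set.mem_Iio, eq_comm]
  rw [latticeCount, h, Set.ncard_image_of_injective, Set.ncard_coe_finset, Finset.card_range]
  intro c d hcd
  have := congrArg (fun x : EuclideanSpace ℝ (Fin n) => x ⟨0, hn⟩) hcd
  simpa using this

/-! ### Unimodular equivalence and the equality case -/

lemma UnimodularEquiv.volume_eq {P Q : Set (EuclideanSpace ℝ (Fin n))}
    (h : UnimodularEquiv P Q) : volume Q = volume P := by
  obtain ⟨U, t, hU, rfl⟩ := h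
  have hdet : |(U.map (Int.cast : ℤ → ℝ)).det| = 1 := by
    have : (U.map (Int.cast : ℤ → ℝ)).det = U.det := by
      simpa using ((Int.castRingHom ℝ).map_det U).symm
    rw [this]
    exact_mod_cast Int.isUnit_iff_abs_eq.1 hU
  have : (fun x : EuclideanSpace ℝ (Fin n) =>
      WithLp.toLp 2 (fun i => (∑ j, (U i j : ℝ) * x j) + (t i : ℝ)))
      = (fun x => WithLp.toLp 2 (fun i => (t i : ℝ)) + x) ∘
        Matrix.toLpLin 2 2 (U.map (Int.cast : ℤ → ℝ)) := by
    ext x i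
    simp [Matrix.toLpLin_apply, Matrix.mulVec, dotProduct, add_comm]
  rw [this, Set.image_comp, Set.image_add_left, measure_preimage_add,
    Measure.addHaar_image_linearMap, LinearMap.det_toLpLin, hdet]
  simp

/-- A lattice simplex of normalized volume `n + 1` whose centroid is a lattice point is
unimodularly equivalent to `simplexS n 1`. -/
lemma unimodularEquiv_simplexS_one (b : AffineBasis (Fin (n + 1)) ℝ (EuclideanSpace ℝ (Fin n)))
    (hb : ∀ i, IsLatticePoint (b i)) {p : EuclideanSpace ℝ (Fin n)} (hp : IsLatticePoint p)
    (hcoord : ∀ i, b.coord i p * (n + 1) = 1) (hdet : |(vertexMatrix b).det| = n + 1) :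
    UnimodularEquiv (convexHull ℝ (Set.range b)) (simplexS n 1) := by
  choose z hz using hb
  obtain ⟨q, hq⟩ := hp
  -- The columns are `b j.succ - p`; the determinant is, up to sign, `(n + 1) / (n + 1)`, by
  -- replacing `b 0` with `p`.
  set M : Matrix (Fin n) (Fin n) ℤ := Matrix.of fun i j => z j.succ i - q i with hM
  have hMdet : IsUnit M.det := by
    have h1 : (M.det : ℝ) = (vertexMatrix (Function.update b 0 p)).det := by
      rw [det_vertexMatrix, ← Matrix.det_transpose M]
      have := (Int.castRingHom ℝ).map_det M.transpose
      rw [eq_intCast] at this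
      rw [this]
      congr 1
      ext i j
      simp [hM, hz, hq, Fin.succ_ne_zero]
    rw [Int.isUnit_iff_abs_eq]
    have h2 : |(M.det : ℝ)| = 1 := by
      have hpos : (0 : ℝ) < n + 1 := by positivity
      have : 0 < b.coord 0 p := by
        rw [eq_div_of_mul_eq hpos.ne' (hcoord 0)]
        positivity
      rw [h1, det_vertexMatrix_update, abs_mul, hdet, abs_of_pos this, hcoord]
    exact_mod_cast h2
  have hUM : M⁻¹ * M = 1 := Matrix.nonsing_inv_mul M hMdet
  refine ⟨M⁻¹, -(M⁻¹.mulVec q), Matrix.isUnit_nonsing_inv_det M hMdet, ?_⟩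
  set L := Matrix.toLpLin 2 2 (M⁻¹.map (Int.cast : ℤ → ℝ)) with hL
  set A : EuclideanSpace ℝ (Fin n) →ᵃ[ℝ] EuclideanSpace ℝ (Fin n) :=
    L.toAffineMap - AffineMap.const ℝ _ (L p) with hA
  have hAx : ∀ x, A x = L (x - p) := by
    intro x
    simp [hA]
  have hAfun : (fun x : EuclideanSpace ℝ (Fin n) => WithLp.toLp 2
      (fun i => (∑ j, (M⁻¹ i j : ℝ) * x j) + ((-(M⁻¹.mulVec q)) i : ℝ))) = A := by
    ext x i
    simp [hAx, hL, Matrix.toLpLin_apply, Matrix.mulVec, dotProduct, hq, sub_eq_add_neg,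
      mul_add, Finset.sum_add_distrib]
  have hsucc : ∀ j : Fin n, A (b j.succ) = EuclideanSpace.single j 1 := by
    intro j
    ext i
    have h1 := congrFun (congrFun hUM i) j
    rw [Matrix.mul_apply] at h1
    have h2 : ∑ k, (M⁻¹ i k : ℝ) * (z j.succ k - q k) = ((1 : Matrix (Fin n) (Fin n) ℤ) i j : ℝ) := by
      rw [← h1]
      simp [hM]
    rw [hAx]
    simpa [hL, Matrix.toLpLin_apply, Matrix.mulVec, dotProduct, hq, hz, Matrix.one_apply,
      PiLp.single_apply] using h2
  -- `A` sends the centroid `p` to 0, so the images of the vertices sum to 0.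
  have hsum : A (b 0) + ∑ j : Fin n, EuclideanSpace.single j (1 : ℝ) = 0 := by
    have h1 : ∑ i, (b i - p) = 0 := by
      have h2 := congrArg (fun x => ((n : ℝ) + 1) • x) (b.linear_combination_coord_eq_self p)
      simp only [Finset.smul_sum, smul_smul, mul_comm _ (b.coord _ p), hcoord, one_smul] at h2
      rw [Finset.sum_sub_distrib, h2]
      simp [add_smul, ← Nat.cast_smul_eq_nsmul ℝ]
    have h3 := congrArg L h1
    rw [map_sum, map_zero, Fin.sum_univ_succ] at h3
    simpa only [← hAx, hsucc] using h3
  have hverts : A ∘ b = simplexVertex n 1 := by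
    ext1 i
    refine Fin.cases ?_ (fun j => ?_) i
    · simp [simplexVertex, eq_neg_of_add_eq_zero_left hsum]
    · simp [simplexVertex, hsucc]
  rw [hAfun, AffineMap.image_convexHull, ← Set.range_comp, hverts, simplexS_eq]

lemma IsLatticePolytope.unimodularEquiv_of_volume_eq (hn : 1 ≤ n)
    {P : Set (EuclideanSpace ℝ (Fin n))} (hP : IsLatticePolytope P)
    (hcount : latticeCount (interior P) = 1)
    (hvol : n.factorial * (volume P).toReal = n + 1) : UnimodularEquiv P (simplexS n 1) := by
  obtain ⟨p, hp⟩ := Set.ncard_eq_one.1 hcount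
  obtain ⟨hpP, hpl⟩ : p ∈ interior P ∧ IsLatticePoint p := by
    have : p ∈ {x | x ∈ interior P ∧ IsLatticePoint x} := hp ▸ Set.mem_singleton p
    exact this
  obtain ⟨ι, _, T, hT, hcov, hpos, h⟩ := hP.exists_dissection_card_add_le hn
  have hle := h {p} (by simpa using ⟨hpP, hpl⟩)
  rw [hvol, Finset.card_singleton, Nat.cast_one, mul_one, add_comm] at hle
  have hcard : Fintype.card ι = 1 := by
    have : (Fintype.card ι : ℝ) ≤ 1 := by linarith
    have : Fintype.card ι ≤ 1 := by exact_mod_cast this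
    omega
  obtain ⟨t, ht⟩ := Fintype.card_eq_one_iff.1 hcard
  have hPt : P = convexHull ℝ (Set.range (T t)) := by
    refine subset_antisymm (fun x hx => ?_) ?_
    · obtain ⟨s, hs⟩ := Set.mem_iUnion.1 (hcov hx)
      rwa [ht s] at hs
    · conv_rhs => rw [← hP.convexHull_extremePoints]
      exact convexHull_mono (Set.range_subset_iff.2 (hT t))
  have hlat : ∀ i, IsLatticePoint (T t i) := fun i => hP.vertices _ (hT t i)
  have hdet : |(vertexMatrix (T t)).det| = n + 1 := by
    rw [← hvol, hPt, volume_convexHull_range, ENNReal.toReal_ofReal (by positivity)]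
    field_simp
  rw [hPt, AffineBasis.interior_convexHull] at hpP
  -- Replacing vertex `i` by `p` gives a nondegenerate lattice simplex. These `n + 1` quantities sum
  -- to `n + 1`, so each equals 1.
  have hge : ∀ i ∈ Finset.univ, 1 ≤ (T t).coord i p * (n + 1) := by
    intro i _
    rw [← hdet, ← abs_of_pos (hpP i), ← abs_mul, ← det_vertexMatrix_update]
    refine one_le_abs_det_vertexMatrix (fun j => ?_) ?_
    · by_cases hj : j = i
      · subst hj
        simpa using hpl
      · simpa [hj] using hlat j
    · rw [det_vertexMatrix_update]
      exact mul_ne_zero (hpP i).ne' (det_vertexMatrix_ne_zero _)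
  have hsum : ∑ i : Fin (n + 1), (1 : ℝ) = ∑ i, (T t).coord i p * (n + 1) := by
    rw [← Finset.sum_mul, (T t).sum_coord_apply_eq_one]
    simp
  have hcoord := (Finset.sum_eq_sum_iff_of_le hge).1 hsum
  rw [hPt]
  exact unimodularEquiv_simplexS_one (T t) hlat hpl
    (fun i => (hcoord i (Finset.mem_univ i)).symm) hdet

end EhrhartVolume

theorem theorem1p2 (n : ℕ) (hn : 1 ≤ n) :
    (∀ P : Set (EuclideanSpace ℝ (Fin n)), EhrhartVolume.IsLatticePolytope P →
      ((n : ℝ) * (EhrhartVolume.latticeCount (interior P) : ℝ) + 1) / (n.factorial : ℝ)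
        ≤ (volume P).toReal) ∧
    (∀ l : ℕ, EhrhartVolume.IsLatticePolytope (EhrhartVolume.simplexS n l) ∧
      EhrhartVolume.latticeCount (interior (EhrhartVolume.simplexS n l)) = l ∧
      (volume (EhrhartVolume.simplexS n l)).toReal
        = ((n : ℝ) * (l : ℝ) + 1) / (n.factorial : ℝ)) ∧
    (∀ P : Set (EuclideanSpace ℝ (Fin n)), EhrhartVolume.IsLatticePolytope P →
      EhrhartVolume.latticeCount (interior P) = 1 →
      ((volume P).toReal
          = ((n : ℝ) * (EhrhartVolume.latticeCount (interior P) : ℝ) + 1) / (n.factorial : ℝ) ↔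
        EhrhartVolume.UnimodularEquiv P (EhrhartVolume.simplexS n 1))) := by
  refine ⟨fun P hP => hP.le_volume hn, fun l => ⟨EhrhartVolume.isLatticePolytope_simplexS n l,
    EhrhartVolume.latticeCount_interior_simplexS hn l, EhrhartVolume.volume_simplexS n l⟩,
    fun P hP hcount => ⟨fun hvol => ?_, fun h => ?_⟩⟩
  · refine hP.unimodularEquiv_of_volume_eq hn hcount ?_
    rw [hvol, hcount]
    field_simp
    simp
  · rw [← h.volume_eq, EhrhartVolume.volume_simplexS, hcount]
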